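/- Let $X, Y, Z$ be finite nonempty sets, with $Z$ identified with $\{0, 1, \dots, |Z|-1\}$, and let $f : X \times Y \to Z$. Let $\mathrm{Qcc}_0(f)$ be the minimum number of qubits exchanged (counted in both directions together) in an entanglement-assisted two-way qubit protocol that computes $f$ exactly: Alice holds $x \in X$ and Bob holds $y \in Y$, each in a basis state of an input register; they share a pure state of an arbitrary finite-dimensional bipartite space that does not depend on the inputs; Bob also holds an output register $\mathbb{C}^{|Z|}$ in state $|0\rangle$. The protocol consists of unitary operators applied by either player to the registers that this player currently holds, and of transmissions of single qubits in either direction. For all $x, y$, measuring Bob's output register at the end must yield $f(x,y)$ with probability $1$. Let $\mathrm{Qoip}_0(f)$ be the minimum number $q$ such that some quantum algorithm making $q$ queries to the oracle $U_{f_x} |y\rangle|a\rangle = |y\rangle|a + f(x,y) \bmod |Z|\rangle$ on $\mathbb{C}^{|Y|} \otimes \mathbb{C}^{|Z|}$ (with arbitrary unitary operators, independent of $x$, on these and on finitely many further dimensions applied before, between and after the queries, and a final measurement) outputs $x$ with probability $1$, for every $x \in X$. If there is no such algorithm (for instance if $f(x,\cdot) = f(x',\cdot)$ for some $x \neq x'$),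 then $\mathrm{Qoip}_0(f) = \infty$. Then $$\mathrm{Qcc}_0(f) \cdot \mathrm{Qoip}_0(f) \geq \tfrac{1}{2} \log_2 |X|,$$ where the left-hand side is read as $\infty$ if one of the factors is infinite (also if the other one is $0$). -/

import Mathlib

open scoped Kronecker ENNReal

/-! A pure state of a register with computational basis `ι` is a unit vector of `ι → ℂ`; the joint
state of two registers with bases `ι` and `κ` is a unit vector of `ι × κ → ℂ`. -/

/-- `ψ` is a unit vector for the Euclidean norm. -/
def IsPureState {ι : Type*} [Fintype ι] (ψ : ι → ℂ) : Prop :=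
  ∑ i, ‖ψ i‖ ^ 2 = 1

/-- The probability that measuring `ψ` in the computational basis gives an `i` not satisfying
`good`. -/
noncomputable def failureProb {ι : Type*} [Fintype ι] (good : ι → Prop) [DecidablePred good]
    (ψ : ι → ℂ) : ℝ :=
  ∑ i, if good i then 0 else ‖ψ i‖ ^ 2

section Communication

/-- What Alice holds: her input register, her part `A` of the fixed workspace, and `p` qubits. -/
abbrev AliceReg (X A : Type*) (p : ℕ) := X × A × (Fin p → Fin 2)

/-- What Bob holds: his input register, his part `B` of the fixed workspace, `q` qubits, and the
output register of dimension `k`. -/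
abbrev BobReg (Y B : Type*) (k q : ℕ) := Y × B × (Fin q → Fin 2) × Fin k

/-- A protocol over a two-way qubit channel that starts with Alice holding `p₀` and Bob holding `q₀`
transmissible qubits (beside their other registers) and has reached a point where they hold `p` and
`q` of them. Each step is a unitary applied by one of the players to everything he or she holds, or
the transmission of one qubit. -/
inductive QubitProtocol (X Y A B : Type*) (k p₀ q₀ : ℕ) [Fintype X] [DecidableEq X] [Fintype Y]
    [DecidableEq Y] [Fintype A] [DecidableEq A] [Fintype B] [DecidableEq B] : ℕ → ℕ → Type _
  | start : QubitProtocol X Y A B k p₀ q₀ p₀ q₀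
  | alice {p q : ℕ} (P : QubitProtocol X Y A B k p₀ q₀ p q)
      (U : Matrix.unitaryGroup (AliceReg X A p) ℂ) : QubitProtocol X Y A B k p₀ q₀ p q
  | bob {p q : ℕ} (P : QubitProtocol X Y A B k p₀ q₀ p q)
      (U : Matrix.unitaryGroup (BobReg Y B k q) ℂ) : QubitProtocol X Y A B k p₀ q₀ p q
  | aliceSends {p q : ℕ} (P : QubitProtocol X Y A B k p₀ q₀ (p + 1) q) :
      QubitProtocol X Y A B k p₀ q₀ p (q + 1)
  | bobSends {p q : ℕ} (P : QubitProtocol X Y A B k p₀ q₀ p (q + 1)) :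
      QubitProtocol X Y A B k p₀ q₀ (p + 1) q

namespace QubitProtocol

variable {X Y A B : Type*} {k p₀ q₀ : ℕ} [Fintype X] [DecidableEq X] [Fintype Y]
    [DecidableEq Y] [Fintype A] [DecidableEq A] [Fintype B] [DecidableEq B]

/-- The number of qubits exchanged, in both directions together. -/
def cost : {p q : ℕ} → QubitProtocol X Y A B k p₀ q₀ p q → ℕ
  | _, _, start => 0
  | _, _, alice P _ => P.cost
  | _, _, bob P _ => P.cost
  | _, _, aliceSends P => P.cost + 1
  | _, _, bobSends P => P.cost + 1

/-- The joint state after running the protocol from the joint state `ψ`. Sending a qubit makes the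
first qubit of the sender the first qubit of the receiver and changes nothing else. -/
noncomputable def run (ψ : AliceReg X A p₀ × BobReg Y B k q₀ → ℂ) :
    {p q : ℕ} → QubitProtocol X Y A B k p₀ q₀ p q → (AliceReg X A p × BobReg Y B k q → ℂ)
  | _, _, start => ψ
  | _, _, alice P U => (U.1 ⊗ₖ 1).mulVec (P.run ψ)
  | _, _, bob P U => (1 ⊗ₖ U.1).mulVec (P.run ψ)
  | _, _, aliceSends P => fun c =>
      match c with
      | ((x, a, u), (y, b, v, z)) => P.run ψ ((x, a, Fin.cons (v 0) u), (y, b, Fin.tail v, z))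
  | _, _, bobSends P => fun c =>
      match c with
      | ((x, a, u), (y, b, v, z)) => P.run ψ ((x, a, Fin.tail u), (y, b, Fin.cons (u 0) v, z))

end QubitProtocol

/-- The initial joint state `|x⟩|y⟩|φ⟩|0⟩`, where `φ` is the state shared by the players, consisting
of both workspaces and all transmissible qubits. -/
noncomputable def initialJointState {X Y A B : Type*} {k p₀ q₀ : ℕ} [NeZero k] [DecidableEq X]
    [DecidableEq Y] (φ : (A × (Fin p₀ → Fin 2)) × (B × (Fin q₀ → Fin 2)) → ℂ) (x : X) (y : Y) :
    AliceReg X A p₀ × BobReg Y B k q₀ → ℂ :=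
  fun ((x', a, u), (y', b, v, z)) =>
    if x' = x ∧ y' = y ∧ z = 0 then φ ((a, u), (b, v)) else 0

/-- Some entanglement-assisted protocol exchanging `c` qubits makes Bob output `f (x, y)` with failure
probability at most `ε` on all inputs. The shared state `φ` is an arbitrary unit vector of an
arbitrary finite-dimensional bipartite space, independent of the inputs. -/
def CommComputes {X Y : Type*} {k : ℕ} [Fintype X] [DecidableEq X] [Fintype Y] [DecidableEq Y]
    [NeZero k] (ε : ℝ) (f : X × Y → Fin k) (c : ℕ) : Prop :=
  ∃ (dA dB p₀ q₀ p q : ℕ)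
    (φ : (Fin dA × (Fin p₀ → Fin 2)) × (Fin dB × (Fin q₀ → Fin 2)) → ℂ)
    (P : QubitProtocol X Y (Fin dA) (Fin dB) k p₀ q₀ p q),
    IsPureState φ ∧ P.cost = c ∧
      ∀ x y, failureProb (fun i => i.2.2.2.2 = f (x, y)) (P.run (initialJointState φ x y)) ≤ ε

/-- The entanglement-assisted two-way qubit communication complexity of `f` with error `ε`
(`⊤` if there is no protocol). -/
noncomputable def Qcc {X Y : Type*} {k : ℕ} [Fintype X] [DecidableEq X] [Fintype Y] [DecidableEq Y]
    [NeZero k] (ε : ℝ) (f : X × Y → Fin k) : ℕ∞ :=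
  ⨅ (c : ℕ) (_ : CommComputes ε f c), (c : ℕ∞)

end Communication

section Query

/-- The oracle of `g : Y → Fin k`: the operator `|y⟩|a⟩ ↦ |y⟩|a + g y mod k⟩`. -/
def oracleMatrix {Y : Type*} {k : ℕ} [DecidableEq Y] [NeZero k] (g : Y → Fin k) :
    Matrix (Y × Fin k) (Y × Fin k) ℂ :=
  Matrix.of fun i j => if i.1 = j.1 ∧ i.2 = j.2 + g j.1 then 1 else 0

/-- The registers of a query algorithm: the query register and the answer register, on which the
oracle acts, and a workspace of dimension `d` and an output register. -/
abbrev QueryReg (X Y : Type*) (k d : ℕ) := (Y × Fin k) × (Fin d × X)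

/-- The state of a query algorithm after `q` queries to the oracle of `g`: the unitary `V 0` is
applied to the initial state, and `V i` is applied after the `i`-th query. -/
noncomputable def queryState {X Y : Type*} {k d : ℕ} [Fintype X] [DecidableEq X] [Fintype Y]
    [DecidableEq Y] [NeZero k] (V : ℕ → Matrix.unitaryGroup (QueryReg X Y k d) ℂ)
    (ψ : QueryReg X Y k d → ℂ) (g : Y → Fin k) : ℕ → (QueryReg X Y k d → ℂ)
  | 0 => (V 0).1.mulVec ψ
  | q + 1 => (V (q + 1)).1.mulVec ((oracleMatrix g ⊗ₖ 1).mulVec (queryState V ψ g q))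

/-- Some quantum algorithm making `q` queries to the oracle of `f (x, ·)` outputs `x` with failure
probability at most `ε`, for every `x`. -/
def QueryIdentifies {X Y : Type*} {k : ℕ} [Fintype X] [DecidableEq X] [Fintype Y] [DecidableEq Y]
    [NeZero k] (ε : ℝ) (f : X × Y → Fin k) (q : ℕ) : Prop :=
  ∃ (d : ℕ) (V : ℕ → Matrix.unitaryGroup (QueryReg X Y k d) ℂ) (ψ : QueryReg X Y k d → ℂ),
    IsPureState ψ ∧
      ∀ x, failureProb (fun i => i.2.2 = x) (queryState V ψ (fun y => f (x, y)) q) ≤ ε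

/-- The quantum query complexity of the oracle identification problem of `f` with error `ε`
(`⊤` if there is no algorithm). -/
noncomputable def Qoip {X Y : Type*} {k : ℕ} [Fintype X] [DecidableEq X] [Fintype Y] [DecidableEq Y]
    [NeZero k] (ε : ℝ) (f : X × Y → Fin k) : ℕ∞ :=
  ⨅ (q : ℕ) (_ : QueryIdentifies ε f q), (q : ℕ∞)

end Query

/-- Multiplication of extended natural numbers with the convention `0 · ∞ = ∞`. -/
noncomputable def mulTop (a b : ℕ∞) : ℕ∞ :=
  if a = ⊤ ∨ b = ⊤ then ⊤ else a * b

/-! Bob alone can identify `x`: he runs the query algorithm and answers each query by running the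
protocol, adding its output to the answer register and undoing the protocol. Exactness leaves the
protocol registers unentangled with the query registers, so queries can be chained coherently.

To measure the communication needed, Bob's reduced states for all `x` are dominated by one positive
operator (`HasCommonBound`). Initially its trace is `1`; local unitaries and qubits sent by Bob do
not raise it, and each qubit reaching Bob costs a factor `4` (`qubit_to_right`). A qubit reaches Bob
in exactly one of the forward and backward runs, so a query costs `4 ^ P.cost`, not its square
(`hasCommonBound_query`). Perfectly distinguishable states number at most the trace (`card_le`), so
`|X| ≤ 4 ^ (c * n)`; then take logarithms. -/

open Matrix

/-! ### Operators dominating all of Bob's reduced states. -/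

section Domination

theorem sum_sq_norm_unitary_mulVec {n : Type*} [Fintype n] [DecidableEq n]
    {U : Matrix n n ℂ} (hU : U ∈ Matrix.unitaryGroup n ℂ) (v : n → ℂ) :
    ∑ i, ‖(U *ᵥ v) i‖ ^ 2 = ∑ i, ‖v i‖ ^ 2 := by
  have key : ∀ w : n → ℂ, ((∑ i, ‖w i‖ ^ 2 : ℝ) : ℂ) = star w ⬝ᵥ w := by
    intro w
    simp only [dotProduct, Pi.star_apply, RCLike.star_def, Complex.conj_mul']
    push_cast
    rfl
  have h : star (U *ᵥ v) ⬝ᵥ (U *ᵥ v) = star v ⬝ᵥ v := by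
    rw [star_mulVec, dotProduct_mulVec, vecMul_vecMul, ← star_eq_conjTranspose,
      mem_unitaryGroup_iff'.1 hU, vecMul_one]
  rw [← key, ← key] at h
  exact_mod_cast h

/-- The reduced states on `B` of the joint states `Ψ x` on `A × B` are all at most one positive
operator of trace at most `C`, namely the reduced operator of the joint vector `W`. -/
def HasCommonBound {ι A B : Type*} [Fintype A] [Fintype B] (Ψ : ι → A → B → ℂ) (C : ℝ) : Prop :=
  ∃ (J : Type) (_ : Fintype J) (W : J → B → ℂ), ∑ j, ∑ b, ‖W j b‖ ^ 2 ≤ C ∧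
    ∀ (x : ι) (l : (B → ℂ) →ₗ[ℂ] ℂ), ∑ a, ‖l (Ψ x a)‖ ^ 2 ≤ ∑ j, ‖l (W j)‖ ^ 2

namespace HasCommonBound

variable {ι A A' B B' : Type*} [Fintype A] [Fintype A'] [Fintype B] [Fintype B']
  {Ψ : ι → A → B → ℂ} {Ψ' : ι → A' → B' → ℂ} {C : ℝ}

theorem map_right {Φ : ι → A → B' → ℂ} (h : HasCommonBound Ψ C) (T : (B → ℂ) →ₗ[ℂ] (B' → ℂ))
    (hT : ∀ w, ∑ b, ‖T w b‖ ^ 2 = ∑ b, ‖w b‖ ^ 2) (hΦ : ∀ x a, Φ x a = T (Ψ x a)) :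
    HasCommonBound Φ C := by
  obtain ⟨J, hJ, W, hC, hW⟩ := h
  refine ⟨J, hJ, fun j => T (W j), by simpa only [hT] using hC, fun x l => ?_⟩
  simpa [hΦ] using hW x (l ∘ₗ T)

theorem unitary_right [DecidableEq B] (h : HasCommonBound Ψ C) {U : Matrix B B ℂ}
    (hU : U ∈ Matrix.unitaryGroup B ℂ) : HasCommonBound (fun x a => U *ᵥ Ψ x a) C :=
  h.map_right U.mulVecLin (fun w => sum_sq_norm_unitary_mulVec hU w) fun _ _ => rfl

theorem reindex_right (h : HasCommonBound Ψ C) (e : B' ≃ B) :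
    HasCommonBound (fun x a b => Ψ x a (e b)) C :=
  h.map_right (LinearMap.funLeft ℂ ℂ e)
    (fun w => Equiv.sum_comp e fun b => ‖w b‖ ^ 2) fun _ _ => rfl

theorem unitary_left [DecidableEq A] (h : HasCommonBound Ψ C) {U : Matrix A A ℂ}
    (hU : U ∈ Matrix.unitaryGroup A ℂ) :
    HasCommonBound (fun x a b => (U *ᵥ fun a' => Ψ x a' b) a) C := by
  obtain ⟨J, hJ, W, hC, hW⟩ := h
  refine ⟨J, hJ, W, hC, fun x l => le_trans (le_of_eq ?_) (hW x l)⟩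
  -- For fixed `l`, the unitary on `A` acts on the vector `a ↦ l (Ψ x a)` and keeps its norm; `W`
  -- need not change.
  rw [← sum_sq_norm_unitary_mulVec hU fun a => l (Ψ x a)]
  refine Finset.sum_congr rfl fun a _ => ?_
  have : (fun b => (U *ᵥ fun a' => Ψ x a' b) a) = ∑ a', U a a' • Ψ x a' := by
    ext b
    simp [mulVec, dotProduct]
  change ‖l (fun b => (U *ᵥ fun a' => Ψ x a' b) a)‖ ^ 2 = _
  rw [this]
  simp [mulVec, dotProduct]

/-- Moving a qubit from the left to the right multiplies the bound by `4`. -/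
theorem qubit_to_right (eA : Fin 2 × A' ≃ A) (eB : Fin 2 × B ≃ B')
    (hΨ : ∀ x a q b, Ψ' x a (eB (q, b)) = Ψ x (eA (q, a)) b) (h : HasCommonBound Ψ C) :
    HasCommonBound Ψ' (4 * C) := by
  obtain ⟨J, hJ, W, hC, hW⟩ := h
  -- `L q` adjoins a qubit in state `|q⟩`.
  let L : Fin 2 → (B → ℂ) →ₗ[ℂ] (B' → ℂ) := fun q =>
    { toFun := fun w b' => if (eB.symm b').1 = q then w (eB.symm b').2 else 0
      map_add' := fun v w => by ext b'; simp only [Pi.add_apply]; split_ifs <;> simp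
      map_smul' := fun c w => by ext b'; simp }
  have hL : ∀ q w, ∑ b', ‖L q w b'‖ ^ 2 = ∑ b, ‖w b‖ ^ 2 := by
    intro q w
    rw [← Equiv.sum_comp eB, Fintype.sum_prod_type]
    rw [Finset.sum_eq_single q]
    · simp [L]
    · intro q' _ hq
      simp [L, hq]
    · simp
  have hsum : ∀ x a, Ψ' x a = ∑ q, L q (Ψ x (eA (q, a))) := by
    intro x a
    ext b'
    obtain ⟨⟨q, b⟩, rfl⟩ := eB.surjective b'
    simp [hΨ, L, Finset.sum_apply]
  have h2 : ‖((√2 : ℝ) : ℂ)‖ ^ 2 = 2 := by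
    rw [Complex.norm_real, Real.norm_eq_abs, sq_abs, Real.sq_sqrt (by norm_num)]
  -- If `σ` is the old bound, the new one is `2 (I ⊗ σ)`: one factor `2` is from `‖u + v‖² ≤ 2 (‖u‖²
  -- + ‖v‖²)`, hence `√2` on vectors, the other is the trace of `I` on the qubit.
  refine ⟨J × Fin 2, inferInstance, fun j => L j.2 (((√2 : ℝ) : ℂ) • W j.1), ?_, fun x l => ?_⟩
  · simp only [hL, Fintype.sum_prod_type, Pi.smul_apply, norm_smul, mul_pow, h2,
      ← Finset.mul_sum, Finset.sum_const, Finset.card_univ, Fintype.card_fin, nsmul_eq_mul]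
    push_cast
    linarith
  · calc ∑ a, ‖l (Ψ' x a)‖ ^ 2
        ≤ ∑ a, 2 * ∑ q, ‖l (L q (Ψ x (eA (q, a))))‖ ^ 2 := by
          refine Finset.sum_le_sum fun a _ => ?_
          rw [hsum, map_sum]
          simp only [Fin.sum_univ_two]
          have := norm_add_le (l (L 0 (Ψ x (eA (0, a))))) (l (L 1 (Ψ x (eA (1, a)))))
          nlinarith [sq_nonneg (‖l (L 0 (Ψ x (eA (0, a))))‖ - ‖l (L 1 (Ψ x (eA (1, a))))‖),
            norm_nonneg (l (L 0 (Ψ x (eA (0, a)))) + l (L 1 (Ψ x (eA (1, a)))))]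
      _ = 2 * ∑ q, ∑ a, ‖l (L q (Ψ x (eA (q, a))))‖ ^ 2 := by
          rw [← Finset.mul_sum, Finset.sum_comm]
      _ ≤ 2 * ∑ q, ∑ a, ‖l (L q (Ψ x a))‖ ^ 2 := by
          gcongr with q
          rw [← Equiv.sum_comp eA, Fintype.sum_prod_type]
          exact Finset.single_le_sum (f := fun q' => ∑ a, ‖l (L q (Ψ x (eA (q', a))))‖ ^ 2)
            (fun _ _ => by positivity) (Finset.mem_univ q)
      _ ≤ 2 * ∑ q, ∑ j, ‖l (L q (W j))‖ ^ 2 := by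
          gcongr with q
          exact hW x (l ∘ₗ L q)
      _ = ∑ j : J × Fin 2, ‖l (L j.2 (((√2 : ℝ) : ℂ) • W j.1))‖ ^ 2 := by
          simp only [map_smul, norm_smul, mul_pow, h2, ← Finset.mul_sum]
          rw [Fintype.sum_prod_type, Finset.sum_comm]

/-- Moving a qubit from the right to the left preserves the bound. -/
theorem qubit_to_left (eA : Fin 2 × A' ≃ A) (eB : Fin 2 × B ≃ B')
    (hΨ : ∀ x a q b, Ψ' x a (eB (q, b)) = Ψ x (eA (q, a)) b) (h : HasCommonBound Ψ' C) :
    HasCommonBound Ψ C := by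
  obtain ⟨J, hJ, W, hC, hW⟩ := h
  -- The new bound is the partial trace of the old one over the departing qubit.
  refine ⟨Fin 2 × J, inferInstance, fun j b => W j.2 (eB (j.1, b)), le_trans (le_of_eq ?_) hC,
    fun x l => ?_⟩
  · rw [Fintype.sum_prod_type, Finset.sum_comm]
    refine Finset.sum_congr rfl fun j _ => ?_
    rw [← Equiv.sum_comp eB, Fintype.sum_prod_type]
  · rw [← Equiv.sum_comp eA, Fintype.sum_prod_type, Fintype.sum_prod_type]
    refine Finset.sum_le_sum fun q _ => ?_
    have := hW x (l ∘ₗ LinearMap.funLeft ℂ ℂ fun b => eB (q, b))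
    refine le_trans (le_of_eq (Finset.sum_congr rfl fun a _ => ?_)) this
    have : Ψ x (eA (q, a)) = LinearMap.funLeft ℂ ℂ (fun b => eB (q, b)) (Ψ' x a) := by
      ext b
      simp [hΨ, LinearMap.funLeft_apply]
    rw [this, LinearMap.comp_apply]

/-- States with a common bound of trace `C` that are perfectly distinguishable by a measurement of
the right register number at most `C`. -/
theorem card_le [Fintype ι] [DecidableEq ι] (h : HasCommonBound Ψ C) (out : B → ι)
    (hΨ : ∀ x, ∑ a, ∑ b, ‖Ψ x a b‖ ^ 2 = 1) (hout : ∀ x a b, out b ≠ x → Ψ x a b = 0) :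
    (Fintype.card ι : ℝ) ≤ C := by
  obtain ⟨J, hJ, W, hC, hW⟩ := h
  refine le_trans ?_ hC
  -- Only diagonal entries matter: the state for `x` has all its weight on `out b = x`, and these
  -- blocks of the diagonal are disjoint.
  have hx : ∀ x, (1 : ℝ) ≤ ∑ b, if out b = x then ∑ j, ‖W j b‖ ^ 2 else 0 := by
    intro x
    rw [← hΨ x, Finset.sum_comm]
    refine Finset.sum_le_sum fun b _ => ?_
    split_ifs with hb
    · simpa using hW x (LinearMap.proj b)
    · simp [hout x _ b hb]
  calc (Fintype.card ι : ℝ) = ∑ _x : ι, 1 := by simp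
    _ ≤ ∑ x, ∑ b, if out b = x then ∑ j, ‖W j b‖ ^ 2 else 0 :=
        Finset.sum_le_sum fun x _ => hx x
    _ = ∑ j, ∑ b, ‖W j b‖ ^ 2 := by
        rw [Finset.sum_comm]
        simp only [Finset.sum_ite_eq, Finset.mem_univ, if_true]
        exact Finset.sum_comm

end HasCommonBound

end Domination

/-! ### Protocols run forwards and backwards on dominated families. -/

section Simulation

theorem kronecker_one_mulVec_apply {m n : Type*} [Fintype m] [Fintype n] [DecidableEq n]
    (U : Matrix m m ℂ) (ψ : m × n → ℂ) (a : m) (b : n) :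
    ((U ⊗ₖ (1 : Matrix n n ℂ)) *ᵥ ψ) (a, b) = (U *ᵥ fun a' => ψ (a', b)) a := by
  simp [mulVec, dotProduct, Fintype.sum_prod_type, one_apply]

theorem one_kronecker_mulVec_apply {m n : Type*} [Fintype m] [Fintype n] [DecidableEq m]
    (U : Matrix n n ℂ) (ψ : m × n → ℂ) (a : m) (b : n) :
    (((1 : Matrix m m ℂ) ⊗ₖ U) *ᵥ ψ) (a, b) = (U *ᵥ fun b' => ψ (a, b')) b := by
  simp [mulVec, dotProduct, Fintype.sum_prod_type, one_apply, ite_mul, Finset.sum_ite_irrel]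

theorem star_mem_unitaryGroup_mulVec {n : Type*} [Fintype n] [DecidableEq n]
    {U : Matrix n n ℂ} (hU : U ∈ Matrix.unitaryGroup n ℂ) (v : n → ℂ) :
    star U *ᵥ (U *ᵥ v) = v := by
  rw [mulVec_mulVec, mem_unitaryGroup_iff'.1 hU, one_mulVec]

/-- Alice's qubits with the first one split off. -/
def aliceQubitEquiv (X A : Type*) (p : ℕ) : Fin 2 × AliceReg X A p ≃ AliceReg X A (p + 1) where
  toFun c := (c.2.1, c.2.2.1, Fin.cons c.1 c.2.2.2)
  invFun c := (c.2.2 0, c.1, c.2.1, Fin.tail c.2.2)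
  left_inv c := by simp
  right_inv c := by simp

/-- Bob's qubits with the first one split off, in the presence of a further register `R`. -/
def bobQubitEquiv (Y B R : Type*) (k q : ℕ) :
    Fin 2 × (BobReg Y B k q × R) ≃ BobReg Y B k (q + 1) × R where
  toFun c := ((c.2.1.1, c.2.1.2.1, Fin.cons c.1 c.2.1.2.2.1, c.2.1.2.2.2), c.2.2)
  invFun c := (c.1.2.2.1 0, (c.1.1, c.1.2.1, Fin.tail c.1.2.2.1, c.1.2.2.2), c.2)
  left_inv c := by simp
  right_inv c := by simp

namespace QubitProtocol

variable {X Y A B R ι : Type*} {k p₀ q₀ : ℕ} [Fintype X] [DecidableEq X] [Fintype Y]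
    [DecidableEq Y] [Fintype A] [DecidableEq A] [Fintype B] [DecidableEq B]

/-- The protocol run on a family of joint states in the presence of a further register `R` of
Bob. -/
noncomputable def runFamily {p q : ℕ} (P : QubitProtocol X Y A B k p₀ q₀ p q)
    (Ψ : ι → AliceReg X A p₀ → BobReg Y B k q₀ × R → ℂ) :
    ι → AliceReg X A p → BobReg Y B k q × R → ℂ :=
  fun x a b => P.run (fun c => Ψ x c.1 (c.2, b.2)) (a, b.1)

/-- Homogeneity lets the amplitude of Bob's inert register `R` be pulled out of the run. -/
theorem run_smul {p q : ℕ} (P : QubitProtocol X Y A B k p₀ q₀ p q)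
    (ψ : AliceReg X A p₀ × BobReg Y B k q₀ → ℂ) (t : ℂ) (c : AliceReg X A p × BobReg Y B k q) :
    P.run (fun c => ψ c * t) c = P.run ψ c * t := by
  induction P with
  | start => rfl
  | alice P U ih =>
    simp only [run, mulVec, dotProduct, ih, Finset.sum_mul, mul_assoc]
  | bob P U ih =>
    simp only [run, mulVec, dotProduct, ih, Finset.sum_mul, mul_assoc]
  | aliceSends P ih => simp only [run, ih]
  | bobSends P ih => simp only [run, ih]

/-- Running a protocol forwards and then backwards multiplies a common bound by `4 ^ cost`: the
factor is `4` for each qubit that reaches Bob. -/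
theorem exists_hasCommonBound_runFamily [Fintype R] [DecidableEq R] {p q : ℕ}
    (P : QubitProtocol X Y A B k p₀ q₀ p q) :
    -- `m` counts the qubits Alice sends and `n` those Bob sends. The backward run is expressed as
    -- passing from a bound on the final family to one on the initial family, so no inverse protocol
    -- is constructed.
    ∃ m n : ℕ, m + n = P.cost ∧
      (∀ (Ψ : ι → AliceReg X A p₀ → BobReg Y B k q₀ × R → ℂ) (C : ℝ),
        HasCommonBound Ψ C → HasCommonBound (P.runFamily Ψ) (4 ^ m * C)) ∧
      ∀ (Ψ : ι → AliceReg X A p₀ → BobReg Y B k q₀ × R → ℂ) (C : ℝ),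
        HasCommonBound (P.runFamily Ψ) C → HasCommonBound Ψ (4 ^ n * C) := by
  induction P with
  | start =>
    refine ⟨0, 0, rfl, fun Ψ C h => ?_, fun Ψ C h => ?_⟩
    · rw [pow_zero, one_mul]
      exact h
    · rw [pow_zero, one_mul]
      exact h
  | alice P U ih =>
    obtain ⟨m, n, hmn, hf, hb⟩ := ih
    have hrun : ∀ Ψ : ι → AliceReg X A p₀ → BobReg Y B k q₀ × R → ℂ,
        (P.alice U).runFamily Ψ = fun x a b => (U.1 *ᵥ fun a' => P.runFamily Ψ x a' b) a := by
      intro Ψ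
      ext x a b
      simp only [runFamily, run, kronecker_one_mulVec_apply]
    refine ⟨m, n, hmn, fun Ψ C h => ?_, fun Ψ C h => hb Ψ C ?_⟩
    · rw [hrun]
      exact (hf Ψ C h).unitary_left U.2
    · rw [hrun] at h
      simpa only [star_mem_unitaryGroup_mulVec U.2] using
        h.unitary_left (Unitary.star_mem U.2)
  | bob P U ih =>
    obtain ⟨m, n, hmn, hf, hb⟩ := ih
    have hU : U.1 ⊗ₖ (1 : Matrix R R ℂ) ∈ Matrix.unitaryGroup (_ × R) ℂ :=
      kronecker_mem_unitary U.2 (one_mem _)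
    have hrun : ∀ Ψ : ι → AliceReg X A p₀ → BobReg Y B k q₀ × R → ℂ,
        (P.bob U).runFamily Ψ =
          fun x a => (U.1 ⊗ₖ (1 : Matrix R R ℂ)) *ᵥ P.runFamily Ψ x a := by
      intro Ψ
      ext x a ⟨b, r⟩
      simp only [runFamily, run, kronecker_one_mulVec_apply, one_kronecker_mulVec_apply]
    refine ⟨m, n, hmn, fun Ψ C h => ?_, fun Ψ C h => hb Ψ C ?_⟩
    · rw [hrun]
      exact (hf Ψ C h).unitary_right hU
    · rw [hrun] at h
      simpa only [star_mem_unitaryGroup_mulVec hU] using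
        h.unitary_right (Unitary.star_mem hU)
  | @aliceSends p q P ih =>
    obtain ⟨m, n, hmn, hf, hb⟩ := ih
    have hrun : ∀ (Ψ : ι → AliceReg X A p₀ → BobReg Y B k q₀ × R → ℂ) x a t b,
        P.aliceSends.runFamily Ψ x a (bobQubitEquiv Y B R k q (t, b)) =
          P.runFamily Ψ x (aliceQubitEquiv X A p (t, a)) b := fun Ψ x a t b => by
      simp [runFamily, run, bobQubitEquiv, aliceQubitEquiv]
    refine ⟨m + 1, n, by simp only [cost]; omega, fun Ψ C h => ?_, fun Ψ C h => hb Ψ C ?_⟩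
    · rw [pow_succ', mul_assoc]
      exact (hf Ψ C h).qubit_to_right _ _ (hrun Ψ)
    · exact h.qubit_to_left _ _ (hrun Ψ)
  | @bobSends p q P ih =>
    obtain ⟨m, n, hmn, hf, hb⟩ := ih
    have hrun : ∀ (Ψ : ι → AliceReg X A p₀ → BobReg Y B k q₀ × R → ℂ) x a t b,
        P.runFamily Ψ x a (bobQubitEquiv Y B R k q (t, b)) =
          P.bobSends.runFamily Ψ x (aliceQubitEquiv X A p (t, a)) b := fun Ψ x a t b => by
      simp [runFamily, run, bobQubitEquiv, aliceQubitEquiv]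
    refine ⟨m, n + 1, by simp only [cost]; omega, fun Ψ C h => ?_, fun Ψ C h => ?_⟩
    · exact (hf Ψ C h).qubit_to_left _ _ (hrun Ψ)
    · rw [pow_succ, mul_assoc]
      exact hb Ψ _ (h.qubit_to_right _ _ (hrun Ψ))

end QubitProtocol

theorem oracleMatrix_kronecker_mulVec_apply {Y W : Type*} {k : ℕ} [Fintype Y] [DecidableEq Y]
    [Fintype W] [DecidableEq W] [NeZero k] (g : Y → Fin k) (s : (Y × Fin k) × W → ℂ)
    (y : Y) (a : Fin k) (w : W) :
    ((oracleMatrix g ⊗ₖ (1 : Matrix W W ℂ)) *ᵥ s) ((y, a), w) = s ((y, a - g y), w) := by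
  rw [kronecker_one_mulVec_apply]
  simp only [mulVec, dotProduct, oracleMatrix, of_apply]
  rw [Finset.sum_eq_single (y, a - g y)]
  · simp
  · rintro ⟨y', a'⟩ _ hne
    rw [if_neg, zero_mul]
    rintro ⟨h1, h2⟩
    dsimp only at h1 h2
    subst h1
    exact hne (by simp [h2])
  · simp

theorem eq_zero_of_failureProb_le_zero {ι : Type*} [Fintype ι] {good : ι → Prop}
    [DecidablePred good] {ψ : ι → ℂ} (h : failureProb good ψ ≤ 0) {i : ι} (hi : ¬ good i) :
    ψ i = 0 := by
  have hnn : ∀ j ∈ Finset.univ, 0 ≤ if good j then (0 : ℝ) else ‖ψ j‖ ^ 2 := by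
    intro j _
    split_ifs <;> positivity
  have := (Finset.sum_eq_zero_iff_of_nonneg hnn).1
    (le_antisymm h (Finset.sum_nonneg hnn)) i (Finset.mem_univ i)
  simpa [hi] using this

/-! ### Simulation of the query algorithm. -/

section Reindex

variable {X Y B : Type*} {k d q : ℕ} [DecidableEq Y] [NeZero k]

/-- Bob exchanges `y₀` with the content of the query register in his input register. -/
def copyQueryEquiv (X B : Type*) (d q : ℕ) (y₀ : Y) :
    BobReg Y B k q × QueryReg X Y k d ≃ BobReg Y B k q × QueryReg X Y k d where
  toFun b := ((Equiv.swap y₀ b.2.1.1 b.1.1, b.1.2), b.2)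
  invFun b := ((Equiv.swap y₀ b.2.1.1 b.1.1, b.1.2), b.2)
  left_inv b := by simp
  right_inv b := by simp

/-- Bob subtracts the protocol's output from the answer register. -/
def subOutputEquiv (X Y B : Type*) (k d q : ℕ) [NeZero k] :
    BobReg Y B k q × QueryReg X Y k d ≃ BobReg Y B k q × QueryReg X Y k d where
  toFun b := (b.1, (b.2.1.1, b.2.1.2 - b.1.2.2.2), b.2.2)
  invFun b := (b.1, (b.2.1.1, b.2.1.2 + b.1.2.2.2), b.2.2)
  left_inv b := by simp
  right_inv b := by simp

end Reindex

variable {X Y : Type*} {k d : ℕ} [Fintype X] [DecidableEq X] [Fintype Y] [DecidableEq Y]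
  [NeZero k]

theorem sum_sq_norm_queryState (V : ℕ → Matrix.unitaryGroup (QueryReg X Y k d) ℂ)
    {ψ : QueryReg X Y k d → ℂ} (hψ : IsPureState ψ) (g : Y → Fin k) (n : ℕ) :
    ∑ r, ‖queryState V ψ g n r‖ ^ 2 = 1 := by
  induction n with
  | zero => exact (sum_sq_norm_unitary_mulVec (V 0).2 ψ).trans hψ
  | succ n ih =>
    refine (sum_sq_norm_unitary_mulVec (V (n + 1)).2 _).trans (Eq.trans ?_ ih)
    rw [Fintype.sum_prod_type, Fintype.sum_prod_type]
    conv_rhs => rw [Fintype.sum_prod_type, Fintype.sum_prod_type]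
    refine Finset.sum_congr rfl fun y _ => ?_
    simp only [oracleMatrix_kronecker_mulVec_apply]
    exact Equiv.sum_comp (Equiv.subRight (g y)) fun a => ∑ w, ‖queryState V ψ g n ((y, a), w)‖ ^ 2

variable {A B : Type} [Fintype A] [Fintype B] {p₀ q₀ : ℕ}

/-- The initial joint state of the protocol beside a state `s` of a further register of Bob. -/
noncomputable def initialFamily {R : Type*}
    (φ : (A × (Fin p₀ → Fin 2)) × (B × (Fin q₀ → Fin 2)) → ℂ) (y₀ : R → Y) (s : X → R → ℂ) :
    X → AliceReg X A p₀ → BobReg Y B k q₀ × R → ℂ :=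
  fun x a b => initialJointState φ x (y₀ b.2) (a, b.1) * s x b.2

theorem sum_sq_norm_initialJointState
    {φ : (A × (Fin p₀ → Fin 2)) × (B × (Fin q₀ → Fin 2)) → ℂ} (hφ : IsPureState φ) (x : X)
    (y : Y) : ∑ a, ∑ b, ‖initialJointState (k := k) φ x y (a, b)‖ ^ 2 = 1 := by
  rw [← hφ]
  simp only [initialJointState, Fintype.sum_prod_type, ite_and, apply_ite (fun z : ℂ => ‖z‖ ^ 2),
    norm_zero, ne_eq, OfNat.ofNat_ne_zero, not_false_eq_true, zero_pow, Finset.sum_ite_irrel,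
    Finset.sum_const_zero, Finset.sum_ite_eq', Finset.mem_univ, if_true]

/-- The input `x` sits only in Alice's register, so Bob's reduced state is the same for all `x` and
serves as its own bound. -/
theorem hasCommonBound_initialFamily {R : Type*} [Fintype R]
    {φ : (A × (Fin p₀ → Fin 2)) × (B × (Fin q₀ → Fin 2)) → ℂ} (hφ : IsPureState φ) (y₀ : Y)
    {ψ : R → ℂ} (hψ : IsPureState ψ) :
    HasCommonBound (initialFamily (k := k) φ (fun _ => y₀) fun _ : X => ψ) 1 := by
  refine ⟨A × (Fin p₀ → Fin 2), inferInstance, fun j b =>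
    if b.1.1 = y₀ ∧ b.1.2.2.2 = 0 then φ (j, (b.1.2.1, b.1.2.2.1)) * ψ b.2 else 0,
    le_of_eq ?_, fun x l => le_of_eq ?_⟩
  · have h : ∑ r, ‖ψ r‖ ^ 2 = 1 := hψ
    rw [← hφ]
    simp only [Fintype.sum_prod_type, ite_and, apply_ite (fun z : ℂ => ‖z‖ ^ 2),
      norm_zero, ne_eq, OfNat.ofNat_ne_zero, not_false_eq_true, zero_pow, Finset.sum_ite_irrel,
      Finset.sum_const_zero, Finset.sum_ite_eq', Finset.mem_univ, if_true, norm_mul, mul_pow,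
      ← Finset.mul_sum, h, mul_one]
  · rw [Fintype.sum_prod_type, Finset.sum_eq_single x]
    · refine Finset.sum_congr rfl fun j _ => ?_
      have : initialFamily (k := k) φ (fun _ => y₀) (fun _ : X => ψ) x (x, j) = fun b =>
          if b.1.1 = y₀ ∧ b.1.2.2.2 = 0 then φ (j, (b.1.2.1, b.1.2.2.1)) * ψ b.2 else 0 := by
        ext b
        simp [initialFamily, initialJointState]
      rw [this]
    · intro x' _ hx'
      refine Finset.sum_eq_zero fun j _ => ?_
      have : initialFamily (k := k) φ (fun _ => y₀) (fun _ : X => ψ) x (x', j) = 0 := by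
        ext b
        simp [initialFamily, initialJointState, hx']
      rw [this]
      simp
    · simp

theorem hasCommonBound_initialFamily_mulVec [DecidableEq B] {R : Type*} [Fintype R]
    [DecidableEq R] {φ : (A × (Fin p₀ → Fin 2)) × (B × (Fin q₀ → Fin 2)) → ℂ} {y₀ : Y}
    {s : X → R → ℂ} {C : ℝ} (U : Matrix.unitaryGroup R ℂ)
    (h : HasCommonBound (initialFamily (k := k) φ (fun _ => y₀) s) C) :
    HasCommonBound (initialFamily (k := k) φ (fun _ => y₀) fun x => U.1 *ᵥ s x) C := by
  have := h.unitary_right (U := (1 : Matrix (BobReg Y B k q₀) (BobReg Y B k q₀) ℂ) ⊗ₖ U.1)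
    (kronecker_mem_unitary (one_mem _) U.2)
  convert this using 1
  ext x a ⟨b, r⟩
  rw [one_kronecker_mulVec_apply]
  simp only [initialFamily, mulVec, dotProduct, Finset.mul_sum]
  exact Finset.sum_congr rfl fun _ _ => by ring

/-- Bob simulates one query by copying the query register, running the protocol, adding its output
to the answer register, and undoing the protocol and the copying. -/
theorem hasCommonBound_query [DecidableEq A] [DecidableEq B] {f : X × Y → Fin k}
    {φ : (A × (Fin p₀ → Fin 2)) × (B × (Fin q₀ → Fin 2)) → ℂ} {p q : ℕ}
    (P : QubitProtocol X Y A B k p₀ q₀ p q)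
    (hP : ∀ x y c, c.2.2.2.2 ≠ f (x, y) → P.run (initialJointState φ x y) c = 0)
    (y₀ : Y) {s : X → QueryReg X Y k d → ℂ} {C : ℝ}
    (h : HasCommonBound (initialFamily (k := k) φ (fun _ => y₀) s) C) :
    HasCommonBound (initialFamily (k := k) φ (fun _ => y₀) fun x =>
      (oracleMatrix (fun y => f (x, y)) ⊗ₖ (1 : Matrix (Fin d × X) (Fin d × X) ℂ)) *ᵥ s x)
      (4 ^ P.cost * C) := by
  -- Bob's input register rests at `y₀` between queries. The controlled swap is an involution, so it
  -- both loads and clears the query.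
  have hcopy : ∀ t : X → QueryReg X Y k d → ℂ, (fun x a b =>
      initialFamily (k := k) φ (fun r => r.1.1) t x a (copyQueryEquiv X B d q₀ y₀ b)) =
      initialFamily (k := k) φ (fun _ => y₀) t := by
    intro t
    ext x a b
    simp only [initialFamily, initialJointState, copyQueryEquiv, Equiv.coe_fn_mk,
      Equiv.swap_apply_eq_iff, Equiv.swap_apply_right]
  have hcopy' : ∀ t : X → QueryReg X Y k d → ℂ, (fun x a b =>
      initialFamily (k := k) φ (fun _ => y₀) t x a (copyQueryEquiv X B d q₀ y₀ b)) =
      initialFamily (k := k) φ (fun r => r.1.1) t := by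
    intro t
    ext x a b
    simp only [initialFamily, initialJointState, copyQueryEquiv, Equiv.coe_fn_mk,
      Equiv.swap_apply_eq_iff, Equiv.swap_apply_left]
  obtain ⟨m, n, hmn, hf, hb⟩ :=
    P.exists_hasCommonBound_runFamily (ι := X) (R := QueryReg X Y k d)
  have h1 := h.reindex_right (copyQueryEquiv X B d q₀ y₀)
  rw [hcopy'] at h1
  -- Pulling amplitudes back along subtraction sends `|a⟩` to `|a + z⟩`.
  have h2 := (hf _ _ h1).reindex_right (subOutputEquiv X Y B k d q)
  have hrun : ∀ t : X → QueryReg X Y k d → ℂ, P.runFamily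
      (initialFamily (k := k) φ (fun r => r.1.1) t) =
      fun x a b => P.run (initialJointState φ x b.2.1.1) (a, b.1) * t x b.2 := by
    intro t
    ext x a b
    exact P.run_smul (initialJointState φ x b.2.1.1) (t x b.2) (a, b.1)
  -- Where the amplitude is nonzero the protocol's output is `f (x, y)`, so adding it is the same as
  -- having queried the oracle before the protocol ran.
  have h3 : (fun x a b => P.runFamily (initialFamily (k := k) φ (fun r => r.1.1) s) x a
      (subOutputEquiv X Y B k d q b)) = P.runFamily (initialFamily (k := k) φ (fun r => r.1.1)
        fun x => (oracleMatrix (fun y => f (x, y)) ⊗ₖ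
          (1 : Matrix (Fin d × X) (Fin d × X) ℂ)) *ᵥ s x) := by
    rw [hrun, hrun]
    ext x a ⟨b, ⟨y, t⟩, w⟩
    simp only [oracleMatrix_kronecker_mulVec_apply, subOutputEquiv, Equiv.coe_fn_mk]
    by_cases hz : b.2.2.2 = f (x, y)
    · rw [hz]
    · rw [hP x y (a, b) hz, zero_mul, zero_mul]
  rw [h3] at h2
  have h4 := (hb _ _ h2).reindex_right (copyQueryEquiv X B d q₀ y₀)
  rw [hcopy, ← mul_assoc, ← pow_add, add_comm, hmn] at h4
  exact h4

theorem hasCommonBound_queryState [DecidableEq A] [DecidableEq B] {f : X × Y → Fin k}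
    {φ : (A × (Fin p₀ → Fin 2)) × (B × (Fin q₀ → Fin 2)) → ℂ} (hφ : IsPureState φ) {p q : ℕ}
    (P : QubitProtocol X Y A B k p₀ q₀ p q)
    (hP : ∀ x y c, c.2.2.2.2 ≠ f (x, y) → P.run (initialJointState φ x y) c = 0)
    (y₀ : Y) (V : ℕ → Matrix.unitaryGroup (QueryReg X Y k d) ℂ)
    {ψ : QueryReg X Y k d → ℂ} (hψ : IsPureState ψ) (n : ℕ) :
    HasCommonBound (initialFamily (k := k) φ (fun _ => y₀) fun x =>
      queryState V ψ (fun y => f (x, y)) n) (4 ^ (P.cost * n)) := by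
  induction n with
  | zero =>
    rw [mul_zero, pow_zero]
    exact hasCommonBound_initialFamily_mulVec (V 0) (hasCommonBound_initialFamily hφ y₀ hψ)
  | succ n ih =>
    rw [Nat.mul_succ, pow_add, mul_comm]
    exact hasCommonBound_initialFamily_mulVec (V (n + 1)) (hasCommonBound_query P hP y₀ ih)

theorem card_le_of_commComputes_of_queryIdentifies [Nonempty Y] {f : X × Y → Fin k} {c n : ℕ}
    (hc : CommComputes 0 f c) (hn : QueryIdentifies 0 f n) :
    (Fintype.card X : ℝ) ≤ 4 ^ (c * n) := by
  obtain ⟨dA, dB, p₀, q₀, p, q, φ, P, hφ, rfl, hP⟩ := hc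
  obtain ⟨d, V, ψ, hψ, hV⟩ := hn
  -- Any fixed element can be the blank content of Bob's input register.
  obtain ⟨y₀⟩ := ‹Nonempty Y›
  refine (hasCommonBound_queryState hφ P
    (fun x y _ hz => eq_zero_of_failureProb_le_zero (hP x y) hz) y₀ V hψ n).card_le
    (fun b => b.2.2.2) (fun x => ?_) fun x a b hb => ?_
  · simp only [initialFamily, norm_mul, mul_pow]
    simp only [Fintype.sum_prod_type (f := fun b : BobReg Y (Fin dB) k q₀ × QueryReg X Y k d => _),
      ← Finset.mul_sum, sum_sq_norm_queryState V hψ, mul_one]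
    exact sum_sq_norm_initialJointState hφ x y₀
  · rw [initialFamily, eq_zero_of_failureProb_le_zero (hV x) hb, mul_zero]

end Simulation

/-! ### Optimal costs and logarithms. -/

theorem exists_eq_iInf_natCast {S : ℕ → Prop} (h : (⨅ (c : ℕ) (_ : S c), (c : ℕ∞)) ≠ ⊤) :
    ∃ c, S c ∧ (⨅ (c : ℕ) (_ : S c), (c : ℕ∞)) = c := by
  classical
  have hex : ∃ c, S c := by
    by_contra hne
    push Not at hne
    exact h (by simp [hne])
  refine ⟨Nat.find hex, Nat.find_spec hex, le_antisymm (iInf₂_le _ (Nat.find_spec hex)) ?_⟩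
  exact le_iInf₂ fun c hc => by exact_mod_cast Nat.find_min' hex hc

/-- `Z` is identified with `{0, …, |Z| - 1}` through an arbitrary bijection `e`. -/
theorem mainTheorem3 {X Y Z : Type*} [Fintype X] [DecidableEq X] [Nonempty X]
    [Fintype Y] [DecidableEq Y] [Nonempty Y] [Fintype Z] [Nonempty Z]
    (e : Z ≃ Fin (Fintype.card Z)) (f : X × Y → Z) :
    ENNReal.ofReal (1 / 2 * Real.logb 2 (Fintype.card X)) ≤
      ((mulTop (Qcc 0 (fun w => e (f w))) (Qoip 0 (fun w => e (f w))) : ℕ∞) : ℝ≥0∞) := by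
  by_cases hcc : Qcc 0 (fun w => e (f w)) = ⊤
  · simp [mulTop, hcc]
  by_cases hq : Qoip 0 (fun w => e (f w)) = ⊤
  · simp [mulTop, hq]
  obtain ⟨c, hc, hc'⟩ := exists_eq_iInf_natCast hcc
  obtain ⟨n, hn, hn'⟩ := exists_eq_iInf_natCast hq
  have hcard := card_le_of_commComputes_of_queryIdentifies hc hn
  rw [mulTop, if_neg (by simp [hcc, hq]), Qcc, Qoip, hc', hn']
  -- The factor `2` comes from `4 = 2 ^ 2`, the price of one qubit.
  have hlog : Real.logb 2 (Fintype.card X) ≤ 2 * (c * n : ℕ) := by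
    rw [Real.logb_le_iff_le_rpow (by norm_num) (by exact_mod_cast Fintype.card_pos)]
    refine hcard.trans (le_of_eq ?_)
    rw [show (2 : ℝ) * (c * n : ℕ) = ((2 * (c * n) : ℕ) : ℝ) by push_cast; ring,
      Real.rpow_natCast, pow_mul (2 : ℝ) 2]
    norm_num
  calc ENNReal.ofReal (1 / 2 * Real.logb 2 (Fintype.card X))
      ≤ ENNReal.ofReal ((c * n : ℕ) : ℝ) := ENNReal.ofReal_le_ofReal (by linarith)
    _ = (((c : ℕ∞) * (n : ℕ∞) : ℕ∞) : ℝ≥0∞) := by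
        rw [ENNReal.ofReal_natCast]
        simp
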